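/- Write $\tau=u+iv\in\mathbb H$ and $q=e^{2\pi i\tau}$. For an integer $\kappa$, a harmonic Maass form of weight $\kappa$ on $\mathrm{SL}_2(\mathbb Z)$ is a smooth function $F:\mathbb H\to\mathbb C$ such that $F\!\left(\frac{a\tau+b}{c\tau+d}\right)=(c\tau+d)^{\kappa}F(\tau)$ for all $\left(\begin{smallmatrix}a&b\\c&d\end{smallmatrix}\right)\in\mathrm{SL}_2(\mathbb Z)$, $\Delta_\kappa F=0$ where $\Delta_\kappa=-v^2(\partial_u^2+\partial_v^2)+i\kappa v(\partial_u+i\partial_v)$, and there are a polynomial $P_F\in\mathbb C[X]$ and $\varepsilon>0$ with $F(\tau)-P_F(q^{-1})=O(e^{-\varepsilon v})$ as $v\to\infty$. Such an $F$ has a Fourier expansion $F=\sum_{l\gg-\infty}c_F^+(l)q^l+\sum_{l<0}c_F^-(l)\Gamma(1-\kappa,-4\pi lv)q^l$, with $P_F(q^{-1})=\sum_{l\le 0}c_F^+(l)q^l$. Put $\xi_\kappa F=2iv^\kappa\,\overline{\partial F/\partial\overline\tau}$, and let $$f\,|\,T_\kappa(n)=n^{\kappa-1}\sum_{ad=n,\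 d>0}d^{-\kappa}\sum_{0\le b<d}f\!\left(\frac{a\tau+b}{d}\right)$$ be the weight $\kappa$ Hecke operator. Let $E_4,E_6$ be the normalized Eisenstein series of weights $4$ and $6$, let $\Delta=(E_4^3-E_6^2)/1728$ and $j=E_4^3/\Delta$. For even $\ell$ set $\widetilde E_\ell=1,\ E_4^2E_6,\ E_4,\ E_6,\ E_4^2,\ E_4E_6$ according as $\ell\equiv 0,2,4,6,8,10\pmod{12}$, and $b(\ell)=\lfloor \ell/12\rfloor$ if $\ell\not\equiv2\pmod{12}$, $b(\ell)=\lfloor \ell/12\rfloor-1$ if $\ell\equiv 2\pmod{12}$. **Theorem.** Let $k$ be an even integer and $m\ge1$ an integer. Let $F$ be a weight $2-k$ harmonic Maass form on $\mathrm{SL}_2(\mathbb Z)$ all of whose Fourier coefficients $c_F^{\pm}(l)$ are real, with holomorphic part $\sum_l c_F^+(l)q^l=q^{-m}+O(q^{-m+1})$. Suppose that its shadow $G=\xi_{2-k}F$ is a Hecke eigenform of weight $k$, that is, $G\ne0$ and $G\,|\,T_k(n)=a(n)G$ for all $n\ge1$. Then for every $n\ge2$: (1) the function $$H_n(F;\tau)=\Delta(\tau)^{b(k-2)}\,\widetilde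 E_{k-2}(\tau)\cdot\left(n^{k-1}F(\tau)\,|\,T_{2-k}(n)-a(n)F(\tau)\right)$$ is a weakly holomorphic modular function on $\mathrm{SL}_2(\mathbb Z)$, that is, it is $\mathrm{SL}_2(\mathbb Z)$-invariant, holomorphic on $\mathbb H$, and meromorphic at the cusp; (2) there is a monic polynomial $P_n(F;x)\in\mathbb R[x]$ of degree $mn-b(k-2)$ such that $P_n(F;j(\tau))=H_n(F;\tau)$ for all $\tau\in\mathbb H$. -/

import Mathlib

open Complex Filter Asymptotics
open UpperHalfPlane hiding I
open scoped ModularForm MatrixGroups Manifold ContDiff Topology ComplexConjugate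

noncomputable section

namespace WeakEigenform

/-- `q = exp(2πiτ)`. -/
def q (τ : ℍ) : ℂ := cexp (2 * Real.pi * I * τ)

/-- `∂f/∂u`, where `z = u + iv`. -/
def partialU (f : ℂ → ℂ) (z : ℂ) : ℂ := fderiv ℝ f z 1

/-- `∂f/∂v`, where `z = u + iv`. -/
def partialV (f : ℂ → ℂ) (z : ℂ) : ℂ := fderiv ℝ f z I

/-- The Wirtinger derivative `∂f/∂z̄ = (∂f/∂u + i ∂f/∂v) / 2`. -/
def dbar (f : ℂ → ℂ) (z : ℂ) : ℂ := (partialU f z + I * partialV f z) / 2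

/-- The weight `κ` hyperbolic Laplacian
`Δ_κ = -v² (∂²/∂u² + ∂²/∂v²) + iκv (∂/∂u + i ∂/∂v)`. -/
def laplacian (κ : ℤ) (F : ℍ → ℂ) (τ : ℍ) : ℂ :=
  -(τ.im : ℂ) ^ 2 * (partialU (partialU (F ∘ ofComplex)) τ + partialV (partialV (F ∘ ofComplex)) τ)
    + I * κ * τ.im * (partialU (F ∘ ofComplex) τ + I * partialV (F ∘ ofComplex) τ)

/-- The operator `ξ_κ F = 2i v^κ · conj (∂F/∂τ̄)`. -/
def xi (κ : ℤ) (F : ℍ → ℂ) (τ : ℍ) : ℂ :=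
  2 * I * (τ.im : ℂ) ^ κ * conj (dbar (F ∘ ofComplex) τ)

/-- `P(q⁻¹)` is the principal part of `F` at the cusp (including the constant term): the difference
`F - P(q⁻¹)` decays exponentially as `v → ∞`.  The polynomial `P` is determined by `F`. In terms of
the Fourier expansion `F = ∑ c⁺(l) q^l + ∑_{l < 0} c⁻(l) Γ(1 - κ, -4πlv) q^l` of a harmonic Maass
form, it is `P(q⁻¹) = ∑_{l ≤ 0} c⁺(l) q^l`. -/
def HasPrincipalPart (F : ℍ → ℂ) (P : Polynomial ℂ) : Prop :=
  ∃ ε : ℝ, 0 < ε ∧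
    (fun τ : ℍ => F τ - P.eval (q τ)⁻¹) =O[atImInfty] fun τ : ℍ => Real.exp (-ε * τ.im)

/-- Harmonic Maass forms of weight `κ` on `SL₂(ℤ)`: smooth, of weight `κ`, annihilated by `Δ_κ`,
and with a principal part in `ℂ[q⁻¹]` at the cusp. -/
structure IsHarmonicMaassForm (κ : ℤ) (F : ℍ → ℂ) : Prop where
  smooth : ContDiffOn ℝ ∞ (F ∘ ofComplex) upperHalfPlaneSet
  slash_eq : ∀ γ : SL(2, ℤ), F ∣[κ] γ = F
  harmonic : ∀ τ : ℍ, laplacian κ F τ = 0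
  principal : ∃ P : Polynomial ℂ, HasPrincipalPart F P

/-- The `l`-th Fourier coefficient `A_l(v)` of `F` as a function of `u`, that is,
`F(u + iv) = ∑_l A_l(v) exp(2πilu)`. -/
def fourierCoeff (F : ℍ → ℂ) (l : ℤ) (v : ℝ) : ℂ :=
  ∫ u in (0 : ℝ)..1, F (ofComplex (u + v * I)) * cexp (-(2 * Real.pi * I * l * u))

/-- `F` has real Fourier coefficients.  For a harmonic Maass form of weight `κ`,
`A_l(v) = c⁺(l) exp(-2πlv)` if `l ≥ 0` and
`A_l(v) = (c⁺(l) + c⁻(l) Γ(1 - κ, -4πlv)) exp(-2πlv)` if `l < 0`, and the incomplete Gamma function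
decreases strictly to `0`; so all `A_l(v)` are real if and only if all `c⁺(l)` and `c⁻(l)` are. -/
def HasRealFourierCoeffs (F : ℍ → ℂ) : Prop :=
  ∀ (l : ℤ) (v : ℝ), 0 < v → (fourierCoeff F l v).im = 0

/-- The weight `κ` Hecke operator
`f | T_κ(n) = n^(κ-1) ∑_{ad = n} d^(-κ) ∑_{0 ≤ b < d} f((aτ + b)/d)`. -/
def hecke (κ : ℤ) (n : ℕ) (f : ℍ → ℂ) (τ : ℍ) : ℂ :=
  (n : ℂ) ^ (κ - 1) * ∑ p ∈ n.divisorsAntidiagonal,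
    (p.2 : ℂ) ^ (-κ) * ∑ b ∈ Finset.range p.2, f (ofComplex ((p.1 * τ + b) / p.2))

/-- `G` is a Hecke eigenform of weight `k` with `T_k(n)`-eigenvalues `a n`. -/
def IsHeckeEigen (k : ℤ) (G : ℍ → ℂ) (a : ℕ → ℂ) : Prop :=
  G ≠ 0 ∧ ∀ n : ℕ, 1 ≤ n → hecke k n G = a n • G

/-- `F` is a weak Hecke eigenform of weight `2 - k`: a harmonic Maass form with real Fourier
coefficients whose shadow `ξ_{2-k} F` is a Hecke eigenform of weight `k`, with eigenvalues `a n`. -/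
structure IsWeakEigenform (k : ℤ) (F : ℍ → ℂ) (a : ℕ → ℂ) : Prop where
  maass : IsHarmonicMaassForm (2 - k) F
  real : HasRealFourierCoeffs F
  shadow : IsHeckeEigen k (xi (2 - k) F) a

/-- Weakly holomorphic modular functions on `SL₂(ℤ)`: invariant, holomorphic on `ℍ`, and
meromorphic (in the variable `q`) at the cusp. -/
structure IsWeaklyHolomorphicFunction (f : ℍ → ℂ) : Prop where
  invariant : ∀ (γ : SL(2, ℤ)) (τ : ℍ), f (γ • τ) = f τ
  holo : MDiff f
  meromorphic : MeromorphicAt (cuspFunction 1 f) 0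

/-- The exponent `b(k)`. -/
def b (k : ℤ) : ℤ := if k % 12 = 2 then k / 12 - 1 else k / 12

/-- The form `Ẽ_k`. -/
def Etilde (k : ℤ) (τ : ℍ) : ℂ :=
  if k % 12 = 2 then ModularForm.E₄ τ ^ 2 * ModularForm.E₆ τ
  else if k % 12 = 4 then ModularForm.E₄ τ
  else if k % 12 = 6 then ModularForm.E₆ τ
  else if k % 12 = 8 then ModularForm.E₄ τ ^ 2
  else if k % 12 = 10 then ModularForm.E₄ τ * ModularForm.E₆ τ
  else 1

/-- The modular `j`-invariant. -/
def j (τ : ℍ) : ℂ := ModularForm.E₄ τ ^ 3 / ModularForm.discriminant τ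

/-- `H_n(F;τ) = Δ^{b(k-2)} Ẽ_{k-2} · (n^{k-1} F | T_{2-k}(n) - a(n) F)`. -/
def H (k : ℤ) (a : ℕ → ℂ) (n : ℕ) (F : ℍ → ℂ) (τ : ℍ) : ℂ :=
  ModularForm.discriminant τ ^ b (k - 2) * Etilde (k - 2) τ *
    ((n : ℂ) ^ (k - 1) * hecke (2 - k) n F τ - a n * F τ)

end WeakEigenform

end

noncomputable section

namespace WeakEigenform

/-! ### The variable `q` -/

/-! The operator `ξ` intertwines `n^(k-1) T_{2-k}(n)` with `T_k(n)` (`xi_hecke`) and is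
conjugate-linear, so `D = n^(k-1) F|T_{2-k}(n) - a(n) F` satisfies `ξ D = (a(n) - conj a(n)) G`.
Real Fourier coefficients mean `F(-conj τ) = conj F(τ)`; this symmetry passes to `G` and commutes
with Hecke operators, so `G ≠ 0` makes `a(n)` real (`conj_eigenvalue_eq`). Hence `D` is holomorphic
(`mdiff_of_xi_eq_zero`), and it has weight `2-k` because right translation by `SL₂(ℤ)` permutes the
Hecke cosets (`hecke_slash`). The factor `Δ^b Ẽ` has weight `k-2`, no poles on `ℍ` and leading term
`q^b`, so `H` is invariant and holomorphic.

At the cusp only the translate `F(nτ)` reaches pole order `mn`, with total coefficient 1, and `a(n)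
F` has the smaller order `m` (`tendsto_H`). Subtracting powers of `j` until a constant remains gives
the polynomial (`exists_polynomial_eval_j`), and the conjugation symmetry makes it real. Since `F`
need not be holomorphic, orders at the cusp are expressed as limits of `f * q^N`. -/

lemma q_eq_qParam (τ : ℍ) : q τ = Function.Periodic.qParam 1 τ := by
  simp [q, Function.Periodic.qParam]

lemma q_ne_zero (τ : ℍ) : q τ ≠ 0 := Complex.exp_ne_zero _

lemma tendsto_q : Tendsto q atImInfty (𝓝 0) := by
  simpa only [← q_eq_qParam] using UpperHalfPlane.qParam_tendsto_atImInfty one_pos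

lemma norm_q (τ : ℍ) : ‖q τ‖ = Real.exp (-2 * Real.pi * τ.im) := by
  rw [q_eq_qParam, Function.Periodic.norm_qParam]; simp

lemma q_J_smul (τ : ℍ) : q (J • τ) = conj (q τ) := by
  simp [q, coe_J_smul, ← Complex.exp_conj, map_ofNat (starRingEnd ℂ)]

lemma mdiff_q : MDiff q := by
  rw [UpperHalfPlane.mdifferentiable_iff]
  have : DifferentiableOn ℂ (fun z : ℂ ↦ cexp (2 * Real.pi * I * z)) {z | 0 < z.im} := by
    fun_prop
  refine this.congr fun z hz ↦ ?_
  simp [q, ofComplex_apply_of_im_pos hz]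

lemma q_one_vadd (τ : ℍ) : q ((1 : ℝ) +ᵥ τ) = q τ := by
  simp only [q, coe_vadd]
  rw [mul_add, Complex.exp_add]
  simp

lemma periodic_ofComplex {f : ℍ → ℂ} (hf : ∀ τ : ℍ, f ((1 : ℝ) +ᵥ τ) = f τ) :
    Function.Periodic (f ∘ ofComplex) ((1 : ℝ) : ℂ) := by
  intro w
  by_cases! hw : 0 < w.im
  · have h1 : 0 < (w + ((1 : ℝ) : ℂ)).im := by simpa using hw
    simp only [Function.comp_apply, ofComplex_apply_of_im_pos hw, ofComplex_apply_of_im_pos h1]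
    rw [← hf ⟨w, hw⟩]
    congr 1
    ext
    simp [add_comm]
  -- Outside `ℍ`, `ofComplex` takes one default value, so periodicity holds there as well.
  · have h1 : (w + ((1 : ℝ) : ℂ)).im ≤ 0 := by simpa using hw
    simp only [Function.comp_apply, ofComplex_apply_of_im_nonpos hw,
      ofComplex_apply_of_im_nonpos h1]

lemma mdiff_zpow {f : ℍ → ℂ} (hf : MDiff f) (h0 : ∀ τ, f τ ≠ 0) (n : ℤ) :
    MDiff (fun τ ↦ f τ ^ n) := by
  rw [UpperHalfPlane.mdifferentiable_iff] at hf ⊢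
  exact fun z hz ↦ (hf z hz).zpow (Or.inl (h0 _))

/-- A holomorphic periodic function that vanishes at `i∞` is `q` times a function that converges. -/
lemma exists_tendsto_div_q {f : ℍ → ℂ} (hper : ∀ τ : ℍ, f ((1 : ℝ) +ᵥ τ) = f τ) (hf : MDiff f)
    (h0 : Tendsto f atImInfty (𝓝 0)) : ∃ c, Tendsto (fun τ ↦ f τ / q τ) atImInfty (𝓝 c) := by
  have hp := periodic_ofComplex hper
  have hb : IsBoundedAtImInfty f := IsZeroAtImInfty.isBoundedAtImInfty h0
  have han := (analyticAt_cuspFunction_zero one_pos hp hf hb).differentiableAt.hasDerivAt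
  have hz : cuspFunction 1 f 0 = 0 := IsZeroAtImInfty.cuspFunction_apply_zero h0 one_pos
  -- The limit is the derivative at `0` of the cusp function, which vanishes there.
  refine ⟨_, ((hasDerivAt_iff_tendsto_slope.mp han).comp
    (tendsto_nhdsWithin_iff.mpr ⟨tendsto_q, .of_forall q_ne_zero⟩)).congr fun τ ↦ ?_⟩
  simp [slope_def_field, hz, q_eq_qParam, eq_cuspFunction τ one_ne_zero hp]

/-! ### Level one forms at the cusp -/

lemma tendsto_E {k : ℕ} (hk : 3 ≤ k) (hk2 : Even k) :
    Tendsto (ModularForm.E hk) atImInfty (𝓝 1) := by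
  have hp := SlashInvariantFormClass.periodic_comp_ofComplex (ModularForm.E hk)
    one_mem_strictPeriods_SL
  have han := ModularFormClass.analyticAt_cuspFunction_zero (ModularForm.E hk) one_pos
    one_mem_strictPeriods_SL
  have h := han.continuousAt.tendsto.comp tendsto_q
  have hc := EisensteinSeries.E_qExpansion_coeff_zero hk hk2
  rw [qExpansion_coeff_zero one_pos han hp,
    ← UpperHalfPlane.cuspFunction_apply_zero one_pos han hp] at hc
  rw [hc] at h
  refine h.congr fun τ ↦ ?_
  simp only [Function.comp_apply, q_eq_qParam]
  exact eq_cuspFunction τ one_ne_zero hp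

/-- The `q`-expansion has rational coefficients, and `J` conjugates `q`. -/
lemma E_J_smul {k : ℕ} (hk : 3 ≤ k) (hk2 : Even k) (τ : ℍ) :
    ModularForm.E hk (J • τ) = conj (ModularForm.E hk τ) := by
  rw [EisensteinSeries.q_expansion_bernoulli hk hk2, EisensteinSeries.q_expansion_bernoulli hk hk2]
  have h : cexp (2 * Real.pi * I * (J • τ : ℍ)) = conj (cexp (2 * Real.pi * I * τ)) := q_J_smul τ
  rw [h]
  simp only [map_sub, map_one, map_mul, map_div₀, Complex.conj_tsum, map_zpow₀, map_natCast,
    map_ratCast, map_ofNat]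

lemma tendsto_discriminant :
    Tendsto (fun τ ↦ ModularForm.discriminant τ / q τ) atImInfty (𝓝 1) := by
  refine ModularForm.tendsto_atImInfty_tprod_one_sub_eta_q_pow.congr fun τ ↦ ?_
  rw [ModularForm.discriminant_eq_q_prod, ← q_eq_qParam, mul_div_cancel_left₀ _ (q_ne_zero τ)]

lemma discriminant_J_smul (τ : ℍ) :
    ModularForm.discriminant (J • τ) = conj (ModularForm.discriminant τ) := by
  rw [ModularForm.discriminant_eq_E₄_cube_sub_E₆_sq, ModularForm.discriminant_eq_E₄_cube_sub_E₆_sq,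
    E_J_smul _ (by decide), E_J_smul _ (by decide)]
  simp only [map_div₀, map_sub, map_pow, map_ofNat]

lemma apply_smul_of_slash_eq {k : ℤ} {f : ℍ → ℂ} {γ : SL(2, ℤ)} (h : f ∣[k] γ = f) (τ : ℍ) :
    f (γ • τ) = denom γ τ ^ k * f τ := by
  have h' := congrFun h τ
  rw [ModularForm.SL_slash_apply] at h'
  rw [← h', mul_comm, mul_assoc, ← zpow_add₀ (denom_ne_zero _ τ)]
  simp

lemma slash_eq_of_apply_smul {k : ℤ} {f : ℍ → ℂ} {γ : SL(2, ℤ)}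
    (h : ∀ τ, f (γ • τ) = denom γ τ ^ k * f τ) : f ∣[k] γ = f := by
  ext τ
  rw [ModularForm.SL_slash_apply, h, mul_comm, ← mul_assoc, ← zpow_add₀ (denom_ne_zero _ τ)]
  simp

lemma modularForm_apply_smul {k : ℤ} (f : ModularForm 𝒮ℒ k) (γ : SL(2, ℤ)) (τ : ℍ) :
    f (γ • τ) = denom γ τ ^ k * f τ :=
  apply_smul_of_slash_eq (SlashInvariantForm.slash_action_eqn f.toSlashInvariantForm
    (γ : GL (Fin 2) ℝ) ⟨γ, rfl⟩) τ

lemma discriminant_smul (γ : SL(2, ℤ)) (τ : ℍ) :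
    ModularForm.discriminant (γ • τ) = denom γ τ ^ (12 : ℤ) * ModularForm.discriminant τ :=
  apply_smul_of_slash_eq (SlashInvariantForm.slash_action_generators_SL2Z
    ModularForm.discriminant_S_invariant ModularForm.discriminant_T_invariant γ) τ

lemma mdiff_discriminant : MDiff ModularForm.discriminant :=
  CuspFormClass.holo CuspForm.discriminant

/-! ### The `j`-invariant -/

lemma j_smul (γ : SL(2, ℤ)) (τ : ℍ) : j (γ • τ) = j τ := by
  have h := denom_ne_zero (γ : GL (Fin 2) ℝ) τ
  have h' := ModularForm.discriminant_ne_zero τ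
  simp only [j, discriminant_smul, modularForm_apply_smul]
  field_simp

lemma j_J_smul (τ : ℍ) : j (J • τ) = conj (j τ) := by
  simp only [j, discriminant_J_smul, E_J_smul _ (show Even 4 by decide), map_div₀, map_pow]

lemma mdiff_j : MDiff j := by
  have h4 : MDiff (ModularForm.E₄ : ℍ → ℂ) := ModularFormClass.holo _
  have hd := mdiff_discriminant
  rw [UpperHalfPlane.mdifferentiable_iff] at *
  exact fun z hz ↦ ((h4 z hz).pow 3).div (hd z hz) (ModularForm.discriminant_ne_zero _)

lemma tendsto_j_mul_q : Tendsto (fun τ ↦ j τ * q τ) atImInfty (𝓝 1) := by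
  have h := ((tendsto_E (by norm_num : 3 ≤ 4) (by decide)).pow 3).div tendsto_discriminant
    one_ne_zero
  simp only [one_pow, div_one] at h
  refine h.congr fun τ ↦ ?_
  have h1 := q_ne_zero τ
  have h' := ModularForm.discriminant_ne_zero τ
  simp only [Pi.div_apply, j]
  field_simp

/-- If `j` were bounded, `j * q` would tend to `0` instead of `1`. Infinitely many values let a
polynomial be recovered from its values on `j`. -/
lemma infinite_range_j : (Set.range j).Infinite := by
  intro hfin
  obtain ⟨C, hC⟩ := hfin.isBounded.exists_norm_le
  have hb : IsBoundedUnder (· ≤ ·) atImInfty (norm ∘ j) :=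
    isBoundedUnder_of ⟨C, fun τ ↦ hC _ ⟨τ, rfl⟩⟩
  exact one_ne_zero (tendsto_nhds_unique tendsto_j_mul_q
    (tendsto_q.zero_mul_isBoundedUnder_le hb |>.congr fun τ ↦ mul_comm _ _))

/-! ### Invariant functions as polynomials in `j` -/

/-- A holomorphic invariant function that converges at `i∞` is constant. -/
lemma eq_const_of_tendsto {f : ℍ → ℂ} (hinv : ∀ (γ : SL(2, ℤ)) (τ : ℍ), f (γ • τ) = f τ)
    (hf : MDiff f) {c : ℂ} (hc : Tendsto f atImInfty (𝓝 c)) (τ : ℍ) : f τ = c := by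
  have hslash (γ : SL(2, ℤ)) : f ∣[(0 : ℤ)] γ = f :=
    slash_eq_of_apply_smul fun τ ↦ by rw [hinv, zpow_zero, one_mul]
  let g : ModularForm 𝒮ℒ 0 :=
    { toFun := f
      slash_action_eq' := by
        rintro _ ⟨γ, rfl⟩
        exact hslash γ
      holo' := hf
      bdd_at_cusps' := fun {c'} hc' ↦ by
        rw [OnePoint.isBoundedAt_iff_forall_SL2Z
          (by simpa [Subgroup.IsArithmetic.isCusp_iff_isCusp_SL2Z] using hc')]
        intro γ _
        rw [hslash γ]
        exact hc.isBigO_one ℝ }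
  obtain ⟨d, hd⟩ := ModularFormClass.levelOne_weight_zero_const g
  have hd' : f = Function.const _ d := hd
  rw [hd'] at hc ⊢
  exact tendsto_nhds_unique tendsto_const_nhds hc

lemma one_vadd_eq_T_smul (τ : ℍ) : (1 : ℝ) +ᵥ τ = ModularGroup.T • τ :=
  (UpperHalfPlane.modular_T_smul τ).symm

/-- A holomorphic invariant function with a pole of order at most `N` at `i∞` is a polynomial of
degree at most `N` in `j`. -/
lemma exists_polynomial_eval_j (N : ℕ) {f : ℍ → ℂ}
    (hinv : ∀ (γ : SL(2, ℤ)) (τ : ℍ), f (γ • τ) = f τ) (hf : MDiff f) {c : ℂ}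
    (hc : Tendsto (fun τ ↦ f τ * q τ ^ N) atImInfty (𝓝 c)) :
    ∃ P : Polynomial ℂ, P.natDegree ≤ N ∧ P.coeff N = c ∧ ∀ τ, P.eval (j τ) = f τ := by
  induction N generalizing f c with
  | zero =>
    refine ⟨.C c, by simp, by simp, fun τ ↦ ?_⟩
    simpa using (eq_const_of_tendsto hinv hf (by simpa using hc) τ).symm
  | succ N ih =>
    set g : ℍ → ℂ := fun τ ↦ f τ - c * j τ ^ (N + 1) with hg
    have hginv (γ : SL(2, ℤ)) (τ : ℍ) : g (γ • τ) = g τ := by simp only [hg, hinv, j_smul]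
    have hgm : MDiff g := by
      have hj := mdiff_j
      rw [UpperHalfPlane.mdifferentiable_iff] at hf hj ⊢
      exact fun z hz ↦ (hf z hz).sub (((hj z hz).pow _).const_mul c)
    have hgq : MDiff (fun τ ↦ g τ * q τ ^ (N + 1)) := by
      have hq := mdiff_q
      rw [UpperHalfPlane.mdifferentiable_iff] at hgm hq ⊢
      exact fun z hz ↦ (hgm z hz).mul ((hq z hz).pow _)
    have hg0 : Tendsto (fun τ ↦ g τ * q τ ^ (N + 1)) atImInfty (𝓝 0) := by
      have h := hc.sub ((tendsto_j_mul_q.pow (N + 1)).const_mul c)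
      simp only [one_pow, mul_one, sub_self] at h
      refine h.congr fun τ ↦ ?_
      simp only [hg]
      ring
    -- Cancelling the leading term lowers the pole order by a whole unit, because `g * q^(N+1)` is
    -- holomorphic in `q`.
    obtain ⟨d, hd⟩ := exists_tendsto_div_q
      (fun τ ↦ by simp only [q_one_vadd]; rw [one_vadd_eq_T_smul, hginv]) hgq hg0
    obtain ⟨P, hP, -, hPe⟩ := ih hginv hgm (hd.congr fun τ ↦ by
      rw [pow_succ, ← mul_assoc, mul_div_cancel_right₀ _ (q_ne_zero τ)])
    refine ⟨P + .C c * .X ^ (N + 1), ?_, ?_, fun τ ↦ ?_⟩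
    · refine (Polynomial.natDegree_add_le _ _).trans (max_le (by omega) ?_)
      exact Polynomial.natDegree_C_mul_X_pow_le _ _
    · simp [Polynomial.coeff_eq_zero_of_natDegree_lt (Nat.lt_succ_of_le hP)]
    · simp [hPe, hg]

/-- A weakly holomorphic function with leading term `q ^ (-N)` and real Fourier coefficients is a
monic real polynomial of degree `N` in `j`. -/
lemma exists_monic_real_polynomial (N : ℤ) {f : ℍ → ℂ}
    (hinv : ∀ (γ : SL(2, ℤ)) (τ : ℍ), f (γ • τ) = f τ) (hf : MDiff f)
    (hc : Tendsto (fun τ ↦ f τ * q τ ^ N) atImInfty (𝓝 1))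
    (hreal : ∀ τ, f (J • τ) = conj (f τ)) :
    ∃ P : Polynomial ℝ, P.Monic ∧ (P.natDegree : ℤ) = N ∧
      ∀ τ, (P.map Complex.ofRealHom).eval (j τ) = f τ := by
  -- For `N < 0` the function would vanish at the cusp, hence identically, against the leading
  -- coefficient `1`.
  have hN : 0 ≤ N := by
    by_contra! hN
    obtain ⟨M, rfl⟩ : ∃ M : ℕ, N = -((M + 1 : ℕ) : ℤ) := ⟨(-N - 1).toNat, by omega⟩
    have h0 : Tendsto f atImInfty (𝓝 0) := by
      have h := hc.mul (tendsto_q.pow (M + 1))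
      simp only [one_mul, ne_eq, Nat.add_eq_zero_iff, one_ne_zero, and_false, not_false_eq_true,
        zero_pow] at h
      refine h.congr fun τ ↦ ?_
      rw [mul_assoc, zpow_neg, zpow_natCast, inv_mul_cancel₀ (pow_ne_zero _ (q_ne_zero τ)), mul_one]
    have hz := eq_const_of_tendsto hinv hf h0
    simp only [hz, zero_mul] at hc
    exact zero_ne_one (tendsto_nhds_unique tendsto_const_nhds hc)
  lift N to ℕ using hN
  simp only [zpow_natCast] at hc
  obtain ⟨P, hPd, hPc, hP⟩ := exists_polynomial_eval_j N hinv hf hc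
  -- `P` and its conjugate agree at every `j τ`, since both `j` and `f` commute with the reflection
  -- `J`.
  have hconj : P.map (starRingEnd ℂ) = P := by
    refine Polynomial.eq_of_infinite_eval_eq _ _ (infinite_range_j.mono ?_)
    rintro _ ⟨τ, rfl⟩
    have h : j τ = conj (j (J • τ)) := by rw [j_J_smul, Complex.conj_conj]
    rw [Set.mem_ofPred_eq]
    conv_lhs => rw [h]
    rw [Polynomial.eval_map, Polynomial.eval₂_hom, hP, hP, hreal, Complex.conj_conj]
  have hlift : P ∈ Polynomial.lifts Complex.ofRealHom := by
    rw [Polynomial.lifts_iff_coeff_lifts]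
    intro i
    have := congrArg (fun Q ↦ Q.coeff i) hconj
    simp only [Polynomial.coeff_map] at this
    exact ⟨_, Complex.conj_eq_iff_re.mp this⟩
  obtain ⟨Q, rfl⟩ := (Polynomial.mem_lifts _).mp hlift
  have hinj : Function.Injective Complex.ofRealHom := Complex.ofRealHom.injective
  rw [Polynomial.natDegree_map_eq_of_injective hinj] at hPd
  have hQc : Q.coeff N = 1 := by
    rw [Polynomial.coeff_map] at hPc
    exact hinj (by simpa using hPc)
  have hdeg : Q.natDegree = N := le_antisymm hPd (Polynomial.le_natDegree_of_ne_zero (by simp [hQc]))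
  refine ⟨Q, ?_, by exact_mod_cast hdeg, hP⟩
  rw [Polynomial.Monic, Polynomial.leadingCoeff, hdeg, hQc]

/-- Multiplication by `q^N` gives a bounded function, whose cusp function is analytic at `0`; near
`0` that of `f` differs from it by the factor `w^(-N)`. -/
lemma meromorphicAt_cuspFunction (N : ℤ) {f : ℍ → ℂ}
    (hper : ∀ τ : ℍ, f ((1 : ℝ) +ᵥ τ) = f τ) (hf : MDiff f) {c : ℂ}
    (hc : Tendsto (fun τ ↦ f τ * q τ ^ N) atImInfty (𝓝 c)) :
    MeromorphicAt (cuspFunction 1 f) 0 := by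
  set g : ℍ → ℂ := fun τ ↦ f τ * q τ ^ N with hg
  have hgper := periodic_ofComplex (f := g) fun τ ↦ by simp only [hg, hper, q_one_vadd]
  have hgm : MDiff g := by
    have hq := mdiff_zpow mdiff_q q_ne_zero N
    rw [UpperHalfPlane.mdifferentiable_iff] at hf hq ⊢
    exact fun z hz ↦ (hf z hz).mul (hq z hz)
  have han := analyticAt_cuspFunction_zero one_pos hgper hgm (hc.isBigO_one ℝ)
  refine (han.meromorphicAt.mul ((MeromorphicAt.id 0).zpow (-N))).congr ?_
  filter_upwards [self_mem_nhdsWithin,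
    nhdsWithin_le_nhds (Metric.ball_mem_nhds (0 : ℂ) one_pos)] with w hw hw1
  have hpos := Function.Periodic.im_invQParam_pos_of_norm_lt_one one_pos
    (mem_ball_zero_iff.mp hw1) hw
  obtain ⟨τ, rfl⟩ : ∃ τ : ℍ, q τ = w :=
    ⟨⟨_, hpos⟩, by rw [q_eq_qParam]; exact Function.Periodic.qParam_right_inv one_ne_zero hw⟩
  have e1 := eq_cuspFunction τ one_ne_zero hgper
  have e2 := eq_cuspFunction τ one_ne_zero (periodic_ofComplex hper)
  rw [← q_eq_qParam] at e1 e2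
  have := zpow_ne_zero N (q_ne_zero τ)
  change cuspFunction 1 g (q τ) * q τ ^ (-N) = cuspFunction 1 f (q τ)
  rw [e1, e2, zpow_neg, mul_inv_cancel_right₀ this]

/-! ### Hecke operators as sums of slash operators -/

section FixedDeterminant

open FixedDetMatrices Matrix

/-- Right translation by `SL₂(ℤ)`. -/
def rightMul {m : ℤ} (A : FixedDetMatrix (Fin 2) ℤ m) (g : SL(2, ℤ)) :
    FixedDetMatrix (Fin 2) ℤ m :=
  ⟨A.1 * g.1, by rw [det_mul, A.2, g.2, mul_one]⟩

lemma smul_rightMul {m : ℤ} (A : FixedDetMatrix (Fin 2) ℤ m) (g h : SL(2, ℤ)) :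
    rightMul (h • A) g = h • rightMul A g := by
  apply FixedDetMatrices.ext'
  exact Matrix.mul_assoc _ _ _ |>.trans rfl

lemma rightMul_injective {m : ℤ} (g : SL(2, ℤ)) :
    Function.Injective fun A : FixedDetMatrix (Fin 2) ℤ m ↦ rightMul A g := by
  intro A B h
  have h' : A.1 * g.1 = B.1 * g.1 := congrArg Subtype.val h
  apply FixedDetMatrices.ext'
  have hg : g.1 * (g⁻¹ : SL(2, ℤ)).1 = 1 := congrArg Subtype.val (mul_inv_cancel g)
  rw [← mul_one A.1, ← mul_one B.1, ← hg, ← Matrix.mul_assoc, ← Matrix.mul_assoc, h']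

variable {n : ℕ} [NeZero n]

/-- An integral matrix of nonzero determinant as an element of `GL₂(ℝ)`. -/
def toGL (A : FixedDetMatrix (Fin 2) ℤ (n : ℤ)) : GL (Fin 2) ℝ :=
  .mkOfDetNeZero (A.1.map (Int.castRingHom ℝ)) (by
    have : (A.1.map (Int.castRingHom ℝ)).det = (Int.castRingHom ℝ) A.1.det :=
      ((Int.castRingHom ℝ).map_det A.1).symm
    rw [this, A.2]
    simpa using NeZero.ne n)

lemma val_toGL (A : FixedDetMatrix (Fin 2) ℤ (n : ℤ)) :
    (toGL A).val = A.1.map (Int.castRingHom ℝ) := rfl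

lemma det_toGL (A : FixedDetMatrix (Fin 2) ℤ (n : ℤ)) : (toGL A).det.val = n := by
  have : (A.1.map (Int.castRingHom ℝ)).det = (Int.castRingHom ℝ) A.1.det :=
    ((Int.castRingHom ℝ).map_det A.1).symm
  rw [GeneralLinearGroup.val_det_apply, val_toGL, this, A.2]
  simp

lemma toGL_smul (g : SL(2, ℤ)) (A : FixedDetMatrix (Fin 2) ℤ (n : ℤ)) :
    toGL (g • A) = (g : GL (Fin 2) ℝ) * toGL A := by
  apply Units.ext
  rw [Units.val_mul, val_toGL, val_toGL, smul_coe, Matrix.map_mul]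
  rfl

lemma toGL_rightMul (A : FixedDetMatrix (Fin 2) ℤ (n : ℤ)) (g : SL(2, ℤ)) :
    toGL (rightMul A g) = toGL A * (g : GL (Fin 2) ℝ) := by
  apply Units.ext
  rw [Units.val_mul, val_toGL, val_toGL, rightMul, Matrix.map_mul]
  rfl

/-- Each Euclidean step of `reduce` is a left multiplication by `S` and a power of `T`, so reduction
stays in the left orbit. -/
lemma exists_smul_eq_reduce {m : ℤ} (A : FixedDetMatrix (Fin 2) ℤ m) :
    ∃ g : SL(2, ℤ), reduce A = g • A := by
  induction A using reduce_rec with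
  | step A h ih =>
    obtain ⟨g, hg⟩ := ih
    rw [reduce_reduceStep h] at hg
    exact ⟨g * (ModularGroup.S * ModularGroup.T ^ (-(A.1 0 0 / A.1 1 0))), by
      rw [hg, reduceStep, mul_smul, mul_smul]⟩
  | base A h =>
    by_cases h1 : 0 < A.1 0 0
    · exact ⟨_, reduce_of_pos h h1⟩
    · exact ⟨ModularGroup.T ^ (-(-A.1 0 1 / -A.1 1 1)) * (ModularGroup.S * ModularGroup.S), by
        rw [reduce_of_not_pos h h1, mul_smul, mul_smul]⟩

lemma apply_mul_apply_of_mem_reps {m : ℤ} {A : FixedDetMatrix (Fin 2) ℤ m} (hA : A ∈ reps m) :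
    A.1 0 0 * A.1 1 1 = m := by
  have := A.2
  rw [det_fin_two, hA.1, mul_zero, sub_zero] at this
  exact this

lemma apply_pos_of_mem_reps {A : FixedDetMatrix (Fin 2) ℤ (n : ℤ)} (hA : A ∈ reps (n : ℤ)) :
    0 < A.1 1 1 := by
  have h := apply_mul_apply_of_mem_reps hA
  have hn : (0 : ℤ) < n := by exact_mod_cast Nat.pos_of_ne_zero (NeZero.ne n)
  exact pos_of_mul_pos_right (h.symm ▸ hn : 0 < A.1 0 0 * A.1 1 1) hA.2.1.le

/-- An element relating two reduced matrices is upper triangular with positive diagonal, hence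
unipotent; it shifts the upper right entry by a multiple of `d`, and `0 ≤ b < d` leaves only the
zero shift. -/
lemma eq_of_smul_eq_of_mem_reps {A B : FixedDetMatrix (Fin 2) ℤ (n : ℤ)} (hA : A ∈ reps (n : ℤ))
    (hB : B ∈ reps (n : ℤ)) {g : SL(2, ℤ)} (h : g • A = B) : A = B := by
  have hAd := apply_pos_of_mem_reps hA
  have hBd := apply_pos_of_mem_reps hB
  obtain ⟨hA0, hAa, hAb, hAbd⟩ := hA
  obtain ⟨hB0, hBa, hBb, hBbd⟩ := hB
  rw [abs_of_nonneg hAb, abs_of_pos hAd] at hAbd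
  rw [abs_of_nonneg hBb, abs_of_pos hBd] at hBbd
  have hv : g.1 * A.1 = B.1 := congrArg Subtype.val h
  have e (i k : Fin 2) : g.1 i 0 * A.1 0 k + g.1 i 1 * A.1 1 k = B.1 i k := by
    rw [← hv, mul_apply, Fin.sum_univ_two]
  have h00 := e 0 0
  have h01 := e 0 1
  have h10 := e 1 0
  have h11 := e 1 1
  rw [hA0, mul_zero, add_zero] at h00 h10
  rw [hB0] at h10
  have hr : g.1 1 0 = 0 := (mul_eq_zero.mp h10).resolve_right hAa.ne'
  have hdet := g.2
  rw [det_fin_two, hr, mul_zero, sub_zero] at hdet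
  have hp : 0 < g.1 0 0 := pos_of_mul_pos_left (h00 ▸ hBa) hAa.le
  have hs : 0 < g.1 1 1 := pos_of_mul_pos_right (hdet.symm ▸ one_pos : 0 < g.1 0 0 * g.1 1 1) hp.le
  have hp1 : g.1 0 0 = 1 := Int.eq_one_of_mul_eq_one_right hp.le hdet
  have hs1 : g.1 1 1 = 1 := by rwa [hp1, one_mul] at hdet
  rw [hp1, one_mul] at h00 h01
  rw [hr, hs1, zero_mul, zero_add, one_mul] at h11
  have hq : g.1 0 1 = 0 := by
    by_contra hq
    rcases lt_or_gt_of_ne hq with hq | hq <;> nlinarith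
  rw [hq, zero_mul, add_zero] at h01
  ext i k
  fin_cases i <;> fin_cases k <;> simp_all

lemma denom_toGL {A : FixedDetMatrix (Fin 2) ℤ (n : ℤ)} (hA : A.1 1 0 = 0) (τ : ℍ) :
    denom (toGL A) τ = A.1 1 1 := by
  simp [denom, val_toGL, hA]

/-- The determinant factor of the slash action is exactly the prefactor `n^(κ-1)` of `hecke`. -/
lemma slash_toGL (κ : ℤ) (f : ℍ → ℂ) {A : FixedDetMatrix (Fin 2) ℤ (n : ℤ)}
    (hA : A.1 1 0 = 0) (τ : ℍ) :
    (f ∣[κ] toGL A) τ = (n : ℂ) ^ (κ - 1) * ((A.1 1 1 : ℂ) ^ (-κ) *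
      f (ofComplex ((A.1 0 0 * τ + A.1 0 1) / A.1 1 1))) := by
  have hn : (0 : ℝ) < n := by exact_mod_cast Nat.pos_of_ne_zero (NeZero.ne n)
  have hpos : 0 < (toGL A).det.val := by rw [det_toGL]; exact hn
  have hσ : σ (toGL A) = .refl ℝ ℂ := by simp only [σ, if_pos hpos]
  have hsmul : toGL A • τ = ofComplex ((A.1 0 0 * τ + A.1 0 1) / A.1 1 1) := by
    rw [← ofComplex_apply (toGL A • τ)]
    congr 1
    rw [coe_smul_of_det_pos hpos, denom_toGL hA]
    simp [num, val_toGL]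
  rw [ModularForm.slash_apply, hσ, det_toGL, denom_toGL hA, hsmul, abs_of_pos hn]
  simp only [ContinuousAlgEquiv.refl_apply]
  push_cast
  ring

/-- The triples `(a, d, b)` are the entries of the reduced matrices of determinant `n`, so the Hecke
sum runs over left `SL₂(ℤ)`-cosets. -/
lemma hecke_eq_sum_slash (κ : ℤ) (f : ℍ → ℂ) :
    hecke κ n f = ∑ A : reps (n : ℤ), f ∣[κ] toGL A.1 := by
  ext τ
  rw [Finset.sum_apply, hecke, Finset.sum_congr rfl fun p _ ↦ Finset.mul_sum ..,
    Finset.sum_sigma', Finset.mul_sum]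
  symm
  refine Finset.sum_bij (fun A _ ↦ ⟨((A.1.1 0 0).toNat, (A.1.1 1 1).toNat), (A.1.1 0 1).toNat⟩)
    ?_ ?_ ?_ ?_
  · rintro ⟨A, hA⟩ -
    have hd := apply_pos_of_mem_reps hA
    have hm := apply_mul_apply_of_mem_reps hA
    obtain ⟨h0, ha, hb, hbd⟩ := hA
    rw [abs_of_nonneg hb, abs_of_pos hd] at hbd
    simp only [Finset.mem_sigma, Nat.mem_divisorsAntidiagonal, Finset.mem_range]
    refine ⟨⟨?_, NeZero.ne n⟩, by omega⟩
    rw [← Int.toNat_mul ha.le hd.le, hm, Int.toNat_natCast]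
  · rintro ⟨A, hA⟩ _ ⟨B, hB⟩ _ h
    have hAd := apply_pos_of_mem_reps hA
    have hBd := apply_pos_of_mem_reps hB
    have ⟨hA0, hAa, hAb, _⟩ := hA
    have ⟨hB0, hBa, hBb, _⟩ := hB
    simp only [Sigma.mk.injEq, Prod.mk.injEq, heq_eq_eq] at h
    obtain ⟨⟨h1, h2⟩, h3⟩ := h
    refine Subtype.ext ?_
    ext i k
    fin_cases i <;> fin_cases k <;> simp only [Fin.zero_eta, Fin.mk_one] <;> omega
  · rintro ⟨⟨a, d⟩, b⟩ h
    simp only [Finset.mem_sigma, Nat.mem_divisorsAntidiagonal, Finset.mem_range] at h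
    obtain ⟨⟨had, hn⟩, hbd⟩ := h
    have ha : 0 < a := Nat.pos_of_ne_zero (by rintro rfl; simp at had; omega)
    refine ⟨⟨⟨!![(a : ℤ), b; 0, d], by simp [det_fin_two, ← had]⟩, ?_⟩, Finset.mem_univ _, ?_⟩
    · exact ⟨rfl, by simpa using ha, by simp, by simpa using hbd⟩
    · simp
  · rintro ⟨A, hA⟩ -
    have hd := apply_pos_of_mem_reps hA
    rw [slash_toGL κ f hA.1]
    have c (z : ℤ) (hz : 0 ≤ z) : ((z.toNat : ℕ) : ℂ) = z := by
      rw [← Int.cast_natCast, Int.toNat_of_nonneg hz]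
    simp only [c _ hd.le, c _ hA.2.1.le, c _ hA.2.2.1]

lemma slash_toGL_smul {κ : ℤ} {f : ℍ → ℂ} (hf : ∀ γ : SL(2, ℤ), f ∣[κ] γ = f) (g : SL(2, ℤ))
    (A : FixedDetMatrix (Fin 2) ℤ (n : ℤ)) : f ∣[κ] toGL (g • A) = f ∣[κ] toGL A := by
  rw [toGL_smul, SlashAction.slash_mul, ← ModularForm.SL_slash, hf]

/-- Hecke operators preserve modularity. -/
lemma hecke_slash {κ : ℤ} {f : ℍ → ℂ} (hf : ∀ γ : SL(2, ℤ), f ∣[κ] γ = f) (γ : SL(2, ℤ)) :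
    hecke κ n f ∣[κ] γ = hecke κ n f := by
  have hn : (n : ℤ) ≠ 0 := by exact_mod_cast NeZero.ne n
  rw [hecke_eq_sum_slash, ModularForm.SL_slash, SlashAction.sum_slash]
  -- `r` sends `A` to the representative of the coset of `A γ`; on a finite set, injectivity makes
  -- it a permutation.
  let r : reps (n : ℤ) → reps (n : ℤ) := fun A ↦
    ⟨reduce (rightMul A.1 γ), reduce_mem_reps hn _⟩
  have hr : Function.Injective r := by
    intro A B h
    have h' : reduce (rightMul A.1 γ) = reduce (rightMul B.1 γ) := congrArg Subtype.val h
    obtain ⟨g, hg⟩ := exists_smul_eq_reduce (rightMul A.1 γ)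
    obtain ⟨g', hg'⟩ := exists_smul_eq_reduce (rightMul B.1 γ)
    rw [hg, hg', ← inv_smul_eq_iff, smul_smul, ← smul_rightMul] at h'
    exact Subtype.ext (eq_of_smul_eq_of_mem_reps A.2 B.2 (rightMul_injective γ h'))
  refine Fintype.sum_bijective r (Finite.injective_iff_bijective.mp hr) _ _ fun A ↦ ?_
  obtain ⟨g, hg⟩ := exists_smul_eq_reduce (rightMul A.1 γ)
  change _ = f ∣[κ] toGL (reduce (rightMul A.1 γ))
  rw [hg, slash_toGL_smul hf, toGL_rightMul, SlashAction.slash_mul]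

end FixedDeterminant

/-! ### Wirtinger derivatives and the operator `ξ` -/

lemma dbar_eq_of_hasFDerivAt {f : ℂ → ℂ} {L : ℂ →L[ℝ] ℂ} {z : ℂ} (h : HasFDerivAt f L z) :
    dbar f z = (L 1 + I * L I) / 2 := by
  rw [dbar, partialU, partialV, h.fderiv]

lemma im_affine_pos (τ : ℍ) {a d : ℕ} (ha : 0 < a) (hd : 0 < d) (b : ℕ) :
    0 < ((a * (τ : ℂ) + b) / d).im := by
  have := τ.im_pos
  have ha' : (0 : ℝ) < a := by exact_mod_cast ha
  have hd' : (0 : ℝ) < d := by exact_mod_cast hd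
  rw [Complex.div_natCast_im]
  simp only [add_im, mul_im, natCast_re, coe_im, natCast_im, zero_mul, add_zero]
  positivity

lemma coe_ofComplex_affine (τ : ℍ) {a d : ℕ} (ha : 0 < a) (hd : 0 < d) (b : ℕ) :
    (ofComplex ((a * (τ : ℂ) + b) / d) : ℂ) = (a * (τ : ℂ) + b) / d := by
  rw [ofComplex_apply_of_im_pos (im_affine_pos τ ha hd b)]

lemma im_ofComplex_affine (τ : ℍ) {a d : ℕ} (ha : 0 < a) (hd : 0 < d) (b : ℕ) :
    (ofComplex ((a * (τ : ℂ) + b) / d)).im = a / d * τ.im := by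
  rw [← coe_im, coe_ofComplex_affine τ ha hd, Complex.div_natCast_im]
  simp only [add_im, mul_im, natCast_re, coe_im, natCast_im, zero_mul, add_zero]
  ring

lemma pos_of_mem_divisorsAntidiagonal {n : ℕ} {p : ℕ × ℕ} (hp : p ∈ n.divisorsAntidiagonal) :
    0 < p.1 ∧ 0 < p.2 := by
  obtain ⟨h, hn⟩ := Nat.mem_divisorsAntidiagonal.mp hp
  constructor <;> refine Nat.pos_of_ne_zero fun h0 ↦ hn ?_ <;> simp [← h, h0]

/-- The derivative of a Hecke translate. -/
lemma hasFDerivAt_hecke (κ : ℤ) (n : ℕ) {F : ℍ → ℂ}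
    (hF : ∀ τ : ℍ, DifferentiableAt ℝ (F ∘ ofComplex) τ) (τ : ℍ) :
    HasFDerivAt (hecke κ n F ∘ ofComplex)
      (((n : ℂ) ^ (κ - 1)) • ∑ p ∈ n.divisorsAntidiagonal,
        ((p.2 : ℂ) ^ (-κ)) • ∑ b ∈ Finset.range p.2, ((p.1 / p.2 : ℝ)) •
          fderiv ℝ (F ∘ ofComplex) (ofComplex ((p.1 * (τ : ℂ) + b) / p.2))) (τ : ℂ) := by
  have main : HasFDerivAt (fun z : ℂ ↦ (n : ℂ) ^ (κ - 1) * ∑ p ∈ n.divisorsAntidiagonal,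
      (p.2 : ℂ) ^ (-κ) * ∑ b ∈ Finset.range p.2, (F ∘ ofComplex) ((p.1 * z + b) / p.2))
      (((n : ℂ) ^ (κ - 1)) • ∑ p ∈ n.divisorsAntidiagonal,
        ((p.2 : ℂ) ^ (-κ)) • ∑ b ∈ Finset.range p.2, ((p.1 / p.2 : ℝ)) •
          fderiv ℝ (F ∘ ofComplex) (ofComplex ((p.1 * (τ : ℂ) + b) / p.2))) (τ : ℂ) := by
    refine (HasFDerivAt.fun_sum fun p hp ↦
      (HasFDerivAt.fun_sum fun b _ ↦ ?_).const_mul _).const_mul _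
    obtain ⟨ha, hd⟩ := pos_of_mem_divisorsAntidiagonal hp
    have h1 := (hF (ofComplex ((p.1 * (τ : ℂ) + b) / p.2))).hasFDerivAt
    have h2 : HasFDerivAt (fun z : ℂ ↦ (p.1 * z + b) / p.2)
        ((p.1 / p.2 : ℝ) • ContinuousLinearMap.id ℝ ℂ) (τ : ℂ) := by
      have h := ((hasFDerivAt_id (𝕜 := ℝ) (τ : ℂ)).const_smul (p.1 / p.2 : ℝ)).add_const
        ((b : ℂ) / p.2)
      refine h.congr_of_eventuallyEq (.of_forall fun z ↦ ?_)
      simp only [Pi.smul_apply, id_eq, Complex.real_smul]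
      push_cast
      ring
    have h3 := coe_ofComplex_affine τ ha hd b
    have h4 := HasFDerivAt.comp (τ : ℂ) (h3 ▸ h1) h2
    rw [ContinuousLinearMap.comp_smul, ContinuousLinearMap.comp_id] at h4
    rw [h3]
    exact h4
  refine main.congr_of_eventuallyEq ?_
  filter_upwards [isOpen_upperHalfPlaneSet.mem_nhds τ.2] with z hz
  simp only [Function.comp_apply, hecke]
  rw [ofComplex_apply_of_im_pos hz]

/-- The inner maps `(aτ + b)/d` have the real derivative `a/d`, which simply multiplies `∂/∂τ̄`. -/
lemma dbar_hecke (κ : ℤ) (n : ℕ) {F : ℍ → ℂ}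
    (hF : ∀ τ : ℍ, DifferentiableAt ℝ (F ∘ ofComplex) τ) (τ : ℍ) :
    dbar (hecke κ n F ∘ ofComplex) τ = (n : ℂ) ^ (κ - 1) * ∑ p ∈ n.divisorsAntidiagonal,
      (p.2 : ℂ) ^ (-κ) * ∑ b ∈ Finset.range p.2, (p.1 / p.2 : ℂ) *
        dbar (F ∘ ofComplex) (ofComplex ((p.1 * (τ : ℂ) + b) / p.2)) := by
  rw [dbar_eq_of_hasFDerivAt (hasFDerivAt_hecke κ n hF τ)]
  simp only [smul_apply, sum_apply, smul_eq_mul,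
    Complex.real_smul, dbar, partialU, partialV]
  push_cast
  rw [mul_left_comm I, ← mul_add, mul_div_assoc, Finset.mul_sum, ← Finset.sum_add_distrib,
    Finset.sum_div]
  congr 1
  refine Finset.sum_congr rfl fun p _ ↦ ?_
  rw [mul_left_comm I, ← mul_add, mul_div_assoc, Finset.mul_sum, ← Finset.sum_add_distrib,
    Finset.sum_div]
  congr 1
  refine Finset.sum_congr rfl fun b _ ↦ ?_
  ring

/-- The operator `ξ` intertwines the Hecke operators. -/
lemma xi_hecke (k : ℤ) {n : ℕ} (hn : n ≠ 0) {F : ℍ → ℂ}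
    (hF : ∀ τ : ℍ, DifferentiableAt ℝ (F ∘ ofComplex) τ) (τ : ℍ) :
    (n : ℂ) ^ (k - 1) * xi (2 - k) (hecke (2 - k) n F) τ = hecke k n (xi (2 - k) F) τ := by
  have hn' : (n : ℂ) ≠ 0 := by exact_mod_cast hn
  rw [xi, dbar_hecke _ _ hF, hecke]
  simp only [map_mul, map_sum, map_zpow₀, map_div₀, map_natCast, Finset.mul_sum]
  -- The sides agree term by term: both terms are `a d^(k-3) · 2i v^(2-k) w`, where `w` is the
  -- conjugated derivative at the translate.
  refine Finset.sum_congr rfl fun p hp ↦ Finset.sum_congr rfl fun b _ ↦ ?_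
  obtain ⟨ha, hd⟩ := pos_of_mem_divisorsAntidiagonal hp
  obtain ⟨hpn, -⟩ := Nat.mem_divisorsAntidiagonal.mp hp
  have ha' : (p.1 : ℂ) ≠ 0 := by exact_mod_cast ha.ne'
  have hd' : (p.2 : ℂ) ≠ 0 := by exact_mod_cast hd.ne'
  have hv : (τ.im : ℂ) ≠ 0 := by exact_mod_cast τ.im_ne_zero
  rw [xi, im_ofComplex_affine τ ha hd]
  generalize conj (dbar (F ∘ ofComplex) _) = w
  have e1 : (n : ℂ) ^ (k - 1) * (n : ℂ) ^ (2 - k - 1) = 1 := by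
    rw [← zpow_add₀ hn', show k - 1 + (2 - k - 1) = 0 by ring, zpow_zero]
  have e2 : (n : ℂ) ^ (k - 1) = (p.1 : ℂ) ^ (k - 1) * (p.2 : ℂ) ^ (k - 1) := by
    rw [← hpn]; push_cast; rw [mul_zpow]
  have e3 : (p.2 : ℂ) ^ (-(2 - k)) = (p.2 : ℂ) ^ (k - 1) * (p.2 : ℂ) ^ (-1 : ℤ) := by
    rw [← zpow_add₀ hd']; congr 1; ring
  have e4 : (p.1 : ℂ) ^ (k - 1) * (p.1 : ℂ) ^ (2 - k) = p.1 := by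
    rw [← zpow_add₀ ha', show k - 1 + (2 - k) = 1 by ring, zpow_one]
  have e5 : (p.2 : ℂ) ^ (-k) * ((p.2 : ℂ) ^ (2 - k))⁻¹ = (p.2 : ℂ) ^ (-2 : ℤ) := by
    rw [← zpow_neg, ← zpow_add₀ hd']; congr 1; ring
  have e6 : (p.2 : ℂ) ^ (-1 : ℤ) * (p.2 : ℂ)⁻¹ = (p.2 : ℂ) ^ (-2 : ℤ) := by
    rw [← zpow_neg_one (p.2 : ℂ), ← zpow_add₀ hd']; norm_num
  push_cast
  rw [mul_zpow, div_zpow, e2, e3]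
  calc _ = ((n : ℂ) ^ (k - 1) * (n : ℂ) ^ (2 - k - 1)) * (p.1 * ((p.2 : ℂ) ^ (k - 1) *
        ((p.2 : ℂ) ^ (-1 : ℤ) * (p.2 : ℂ)⁻¹))) * (2 * I * (τ.im : ℂ) ^ (2 - k) * w) := by
          rw [e2]; ring
    _ = ((p.1 : ℂ) ^ (k - 1) * (p.1 : ℂ) ^ (2 - k)) * ((p.2 : ℂ) ^ (k - 1) *
        ((p.2 : ℂ) ^ (-k) * ((p.2 : ℂ) ^ (2 - k))⁻¹)) * (2 * I * (τ.im : ℂ) ^ (2 - k) * w) := by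
          rw [e1, e4, e5, e6]
          ring
    _ = _ := by ring

/-- The conjugates on the scalars are what makes the reality of `a(n)` necessary. -/
lemma xi_mul_sub_mul (κ : ℤ) {F G : ℍ → ℂ} (c e : ℂ)
    (hF : ∀ τ : ℍ, DifferentiableAt ℝ (F ∘ ofComplex) τ)
    (hG : ∀ τ : ℍ, DifferentiableAt ℝ (G ∘ ofComplex) τ) (τ : ℍ) :
    xi κ (fun τ ↦ c * F τ - e * G τ) τ = conj c * xi κ F τ - conj e * xi κ G τ := by
  have h := (((hF τ).hasFDerivAt.const_mul c).sub ((hG τ).hasFDerivAt.const_mul e))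
  have h' : dbar ((fun τ ↦ c * F τ - e * G τ) ∘ ofComplex) τ =
      c * dbar (F ∘ ofComplex) τ - e * dbar (G ∘ ofComplex) τ := by
    refine (dbar_eq_of_hasFDerivAt h).trans ?_
    simp only [sub_apply, smul_apply, smul_eq_mul, dbar,
      partialU, partialV]
    ring
  simp only [xi, h', map_sub, map_mul]
  ring

/-- As `v^κ ≠ 0`, the vanishing of `ξ` is the Cauchy–Riemann equation. -/
lemma mdiff_of_xi_eq_zero {κ : ℤ} {F : ℍ → ℂ}
    (hF : ∀ τ : ℍ, DifferentiableAt ℝ (F ∘ ofComplex) τ) (h : ∀ τ, xi κ F τ = 0) : MDiff F := by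
  rw [UpperHalfPlane.mdifferentiable_iff]
  intro z hz
  refine DifferentiableAt.differentiableWithinAt ?_
  have hd := hF ⟨z, hz⟩
  have hx := h ⟨z, hz⟩
  have hv : (((⟨z, hz⟩ : ℍ).im : ℂ)) ≠ 0 := by exact_mod_cast UpperHalfPlane.im_ne_zero _
  simp only [xi, mul_eq_zero, zpow_ne_zero _ hv, OfNat.ofNat_ne_zero, I_ne_zero, or_self, map_eq_zero,
    false_or] at hx
  rw [differentiableAt_complex_iff_differentiableAt_real]
  refine ⟨hd, ?_⟩
  simp only [dbar, partialU, partialV, div_eq_zero_iff, OfNat.ofNat_ne_zero, or_false] at hx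
  rw [smul_eq_mul]
  linear_combination -I * hx + (fderiv ℝ (F ∘ ofComplex) z I) * I_mul_I

/-! ### Reality -/

lemma J_smul_im (τ : ℍ) : (J • τ).im = τ.im := by
  rw [← coe_im, coe_J_smul]; simp

lemma J_smul_ofComplex {z : ℂ} (hz : 0 < z.im) : J • ofComplex z = ofComplex (-conj z) := by
  have h : 0 < (-conj z).im := by simpa using hz
  ext
  rw [coe_J_smul, ofComplex_apply_of_im_pos hz, ofComplex_apply_of_im_pos h]

/-- Zero coefficients are summable, so the Fourier series of the continuous function converges to it
pointwise. -/
lemma eq_zero_of_forall_integral_eq_zero {h : ℝ → ℂ} (hc : Continuous h)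
    (hper : Function.Periodic h 1)
    (h0 : ∀ l : ℤ, ∫ u in (0 : ℝ)..1, h u * cexp (-(2 * Real.pi * I * l * u)) = 0) (u : ℝ) :
    h u = 0 := by
  let g : C(AddCircle (1 : ℝ), ℂ) := ⟨hper.lift, hc.quotient_liftOn' _⟩
  have hg (l : ℤ) : _root_.fourierCoeff g l = 0 := by
    rw [fourierCoeff_eq_intervalIntegral _ _ 0]
    simp only [zero_add, div_one, one_smul]
    rw [← h0 l]
    refine intervalIntegral.integral_congr fun x _ ↦ ?_
    have e : g (x : AddCircle (1 : ℝ)) = h x := hper.lift_coe x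
    simp only [fourier_coe_apply, e, smul_eq_mul]
    rw [mul_comm]
    congr 2
    push_cast
    ring
  have hs := has_pointwise_sum_fourier_series_of_summable (f := g)
    (by rw [show _root_.fourierCoeff g = 0 from funext hg]; exact summable_zero) (u : AddCircle (1 : ℝ))
  simp only [hg, zero_smul] at hs
  exact (hper.lift_coe u).symm.trans (hs.unique hasSum_zero)

/-- A continuous periodic function with real Fourier coefficients commutes with complex
conjugation. -/
lemma apply_J_smul_of_hasRealFourierCoeffs {F : ℍ → ℂ} (hF : Continuous F)
    (hper : ∀ τ : ℍ, F ((1 : ℝ) +ᵥ τ) = F τ) (hreal : HasRealFourierCoeffs F) (τ : ℍ) :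
    F (J • τ) = conj (F τ) := by
  set v := τ.im with hv
  have hvpos : 0 < v := τ.im_pos
  set g : ℝ → ℂ := fun u ↦ F (ofComplex (u + v * I)) with hg
  have him (u : ℝ) : 0 < ((u : ℂ) + v * I).im := by simpa using hvpos
  have hgc : Continuous g := by
    refine hF.comp (continuous_iff_continuousAt.mpr fun u ↦ ?_)
    refine ContinuousAt.comp (f := fun u : ℝ ↦ (u : ℂ) + v * I) ?_ (by fun_prop)
    exact (contMDiffAt_ofComplex (n := 0) (him u)).continuousAt
  have hgper : Function.Periodic g 1 := fun u ↦ by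
    have := periodic_ofComplex hper (u + v * I)
    simp only [hg]
    rw [← Function.comp_apply (f := F), ← Function.comp_apply (f := F), ← this]
    congr 1
    push_cast
    ring
  -- The coefficients of `conj (g (-u))` are the conjugates of those of `g`, hence equal to them.
  have key (l : ℤ) : ∫ u in (0 : ℝ)..1, conj (g (-u)) * cexp (-(2 * Real.pi * I * l * u)) =
      ∫ u in (0 : ℝ)..1, g u * cexp (-(2 * Real.pi * I * l * u)) := by
    have hr : conj (∫ u in (0 : ℝ)..1, g u * cexp (-(2 * Real.pi * I * l * u))) =
        ∫ u in (0 : ℝ)..1, g u * cexp (-(2 * Real.pi * I * l * u)) :=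
      Complex.conj_eq_iff_im.mpr (hreal l v hvpos)
    set w : ℝ → ℂ := fun u ↦ g u * cexp (-(2 * Real.pi * I * l * u)) with hw
    have hwper : Function.Periodic w 1 := fun u ↦ by
      simp only [hw]
      rw [hgper u]
      congr 1
      rw [Complex.exp_eq_exp_iff_exists_int]
      exact ⟨-l, by push_cast; ring⟩
    have hcong (u : ℝ) : conj (g (-u)) * cexp (-(2 * Real.pi * I * l * u)) = conj (w (-u)) := by
      simp only [hw, map_mul, ← Complex.exp_conj]
      congr 2
      simp only [map_neg, map_mul, Complex.conj_ofReal, Complex.conj_I, map_intCast,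
        map_ofNat]
      push_cast
      ring
    simp only [hcong]
    rw [← hr, intervalIntegral.integral_comp_neg (fun u ↦ conj (w u)),
      intervalIntegral.intervalIntegral_conj]
    have := hwper.intervalIntegral_add_eq (-1) 0
    simp only [neg_add_cancel, zero_add] at this
    rw [neg_zero, this]
  have hzero := eq_zero_of_forall_integral_eq_zero (h := fun u ↦ g u - conj (g (-u)))
    (by fun_prop) (fun u ↦ by
      simp only [neg_add]
      rw [hgper u, ← sub_eq_add_neg, hgper.sub_eq]) (fun l ↦ by
      simp only [sub_mul]
      rw [intervalIntegral.integral_sub, key, sub_self]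
      all_goals exact Continuous.intervalIntegrable (by fun_prop) _ _) (-τ.re)
  simp only [hg, neg_neg] at hzero
  rw [sub_eq_zero] at hzero
  have e1 : ((τ.re : ℂ) + v * I) = τ := by
    apply Complex.ext <;> simp [hv]
  have e2 : (((-τ.re : ℝ) : ℂ) + v * I) = (J • τ : ℍ) := by
    rw [coe_J_smul]
    apply Complex.ext <;> simp [hv]
  rwa [e1, e2, ofComplex_apply, ofComplex_apply] at hzero

lemma xi_one_vadd (κ : ℤ) {F : ℍ → ℂ} (hper : ∀ τ : ℍ, F ((1 : ℝ) +ᵥ τ) = F τ) (τ : ℍ) :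
    xi κ F ((1 : ℝ) +ᵥ τ) = xi κ F τ := by
  have h : fderiv ℝ (F ∘ ofComplex) (((1 : ℝ) : ℂ) + τ) = fderiv ℝ (F ∘ ofComplex) τ := by
    have e : F ∘ ofComplex = fun z ↦ (F ∘ ofComplex) (((1 : ℝ) : ℂ) + z) := by
      ext z
      rw [add_comm]
      exact (periodic_ofComplex hper z).symm
    conv_rhs => rw [e]
    rw [fderiv_comp_add_left]
  simp only [xi, dbar, partialU, partialV, vadd_im, coe_vadd, h]

/-- The chain rule applied to `F = conj ∘ F ∘ J` gives `∂F/∂τ̄` a minus sign, which the conjugation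
of `2i` absorbs. -/
lemma xi_J_smul (κ : ℤ) {F : ℍ → ℂ}
    (hF : ∀ τ : ℍ, DifferentiableAt ℝ (F ∘ ofComplex) τ)
    (hreal : ∀ τ, F (J • τ) = conj (F τ)) (τ : ℍ) :
    xi κ F (J • τ) = conj (xi κ F τ) := by
  have hd : HasFDerivAt (F ∘ ofComplex) ((conjCLE : ℂ →L[ℝ] ℂ) ∘L (fderiv ℝ (F ∘ ofComplex) τ) ∘L
      (-(conjCLE : ℂ →L[ℝ] ℂ))) (J • τ : ℍ) := by
    have h1 : HasFDerivAt (fun z : ℂ ↦ -conj z) (-(conjCLE : ℂ →L[ℝ] ℂ)) (J • τ : ℍ) :=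
      (conjCLE.hasFDerivAt).neg
    have h2 : -conj ((J • τ : ℍ) : ℂ) = τ := by rw [coe_J_smul]; simp
    have h3 := (hF τ).hasFDerivAt
    have h4 := (conjCLE.hasFDerivAt (x := (F ∘ ofComplex) τ)).comp (τ : ℂ) h3
    rw [← h2] at h4
    have h5 := HasFDerivAt.comp (f := fun z : ℂ ↦ -conj z) _ h4 h1
    rw [h2] at h5
    refine h5.congr_of_eventuallyEq ?_
    filter_upwards [isOpen_upperHalfPlaneSet.mem_nhds (J • τ).2] with z hz
    simp only [Function.comp_apply, conjCLE_apply]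
    rw [← J_smul_ofComplex hz, hreal, Complex.conj_conj]
  have hdbar : dbar (F ∘ ofComplex) (J • τ : ℍ) = -conj (dbar (F ∘ ofComplex) τ) := by
    rw [dbar_eq_of_hasFDerivAt hd]
    simp [dbar, partialU, partialV, map_ofNat (starRingEnd ℂ)]
    ring
  rw [xi, xi, hdbar, J_smul_im]
  simp [map_ofNat (starRingEnd ℂ)]

/-- `J` turns the translate with `b` into the one with `-b`, and `b ↦ -b` permutes the residues
modulo `d`. -/
lemma hecke_J_smul (κ : ℤ) (n : ℕ) {F : ℍ → ℂ} (hper : ∀ τ : ℍ, F ((1 : ℝ) +ᵥ τ) = F τ)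
    (hreal : ∀ τ, F (J • τ) = conj (F τ)) (τ : ℍ) :
    hecke κ n F (J • τ) = conj (hecke κ n F τ) := by
  simp only [hecke, map_mul, map_sum, map_zpow₀, map_natCast]
  congr 1
  refine Finset.sum_congr rfl fun p hp ↦ ?_
  obtain ⟨ha, hd⟩ := pos_of_mem_divisorsAntidiagonal hp
  have hd' : (p.2 : ℂ) ≠ 0 := by exact_mod_cast hd.ne'
  congr 1
  have hp' := periodic_ofComplex hper
  set φ : ℕ → ℂ := fun b ↦ (F ∘ ofComplex) ((p.1 * (J • τ : ℍ) + b) / p.2) with hφ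
  have hφd : φ p.2 = φ 0 := by
    simp only [hφ]
    rw [← hp' ((p.1 * (J • τ : ℍ) + (0 : ℕ)) / p.2)]
    congr 1
    field_simp
    simp
  have hconj (b : ℕ) (hb : b < p.2) :
      conj (F (ofComplex ((p.1 * τ + b) / p.2))) = φ (p.2 - 1 - b + 1) := by
    rw [← hreal, J_smul_ofComplex (im_affine_pos τ ha hd b)]
    simp only [hφ]
    rw [← Function.comp_apply (f := F), ← hp']
    congr 1
    rw [show p.2 - 1 - b + 1 = p.2 - b by omega, Nat.cast_sub hb.le, coe_J_smul]
    simp only [map_div₀, map_add, map_mul, map_natCast]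
    field_simp
    push_cast
    ring
  -- The reflected sum runs over `1, ..., d` instead of `0, ..., d - 1`; `φ d = φ 0` closes the gap.
  rw [Finset.sum_congr rfl fun b hb ↦ hconj b (Finset.mem_range.mp hb),
    Finset.sum_range_reflect (fun b ↦ φ (b + 1)) p.2]
  change ∑ b ∈ Finset.range p.2, φ b = _
  have h1 := Finset.sum_range_succ φ p.2
  rw [Finset.sum_range_succ', hφd] at h1
  exact (add_right_cancel h1).symm

/-- Hecke eigenvalues of real eigenforms are real. -/
lemma conj_eigenvalue_eq {κ : ℤ} {n : ℕ} {G : ℍ → ℂ} {a : ℂ}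
    (hper : ∀ τ : ℍ, G ((1 : ℝ) +ᵥ τ) = G τ) (hreal : ∀ τ, G (J • τ) = conj (G τ)) (hG : G ≠ 0)
    (h : hecke κ n G = a • G) : conj a = a := by
  obtain ⟨τ, hτ⟩ := Function.ne_iff.mp hG
  have h1 := hecke_J_smul κ n hper hreal τ
  rw [h, Pi.smul_apply, Pi.smul_apply, hreal, smul_eq_mul, smul_eq_mul, map_mul] at h1
  exact (mul_right_cancel₀ (by simpa using hτ) h1).symm

/-! ### The weight `k` factor `Δ^{b(k)} Ẽ_k` -/

lemma Etilde_smul {k : ℤ} (hk : Even k) (γ : SL(2, ℤ)) (τ : ℍ) :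
    Etilde k (γ • τ) = denom γ τ ^ (k - 12 * b k) * Etilde k τ := by
  -- Residue `2` uses weight `14`, which is why `b` drops by one there.
  have hw : k - 12 * b k = if k % 12 = 2 then 14 else k % 12 := by
    unfold b; split_ifs <;> omega
  have hd := denom_ne_zero (γ : GL (Fin 2) ℝ) τ
  rw [hw]
  unfold Etilde
  split_ifs with h2 h4 h6 h8 h10
  · simp only [modularForm_apply_smul]
    rw [show (14 : ℤ) = 4 * 2 + 6 by norm_num, zpow_add₀ hd, zpow_mul]
    simp only [zpow_ofNat]
    ring
  · simp only [modularForm_apply_smul, h4]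
  · simp only [modularForm_apply_smul, h6]
  · simp only [modularForm_apply_smul, h8]
    rw [show (8 : ℤ) = 4 * 2 by norm_num, zpow_mul]
    simp only [zpow_ofNat]
    ring
  · simp only [modularForm_apply_smul, h10]
    rw [show (10 : ℤ) = 4 + 6 by norm_num, zpow_add₀ hd]
    ring
  · have h0 : k % 12 = 0 := by
      obtain ⟨r, hr⟩ := hk
      omega
    rw [h0, zpow_zero, one_mul]

lemma mdiff_Etilde (k : ℤ) : MDiff (Etilde k) := by
  have h4 : MDiff (ModularForm.E₄ : ℍ → ℂ) := ModularFormClass.holo _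
  have h6 : MDiff (ModularForm.E₆ : ℍ → ℂ) := ModularFormClass.holo _
  rw [UpperHalfPlane.mdifferentiable_iff] at *
  intro z hz
  have h4 := h4 z hz
  have h6 := h6 z hz
  unfold Etilde
  split_ifs
  exacts [(h4.pow 2).mul h6, h4, h6, h4.pow 2, h4.mul h6, differentiableWithinAt_const _]

lemma Etilde_J_smul (k : ℤ) (τ : ℍ) : Etilde k (J • τ) = conj (Etilde k τ) := by
  unfold Etilde
  split_ifs <;> simp only [E_J_smul _ (show Even 4 by decide), E_J_smul _ (show Even 6 by decide),
    map_mul, map_pow, map_one]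

lemma tendsto_Etilde (k : ℤ) : Tendsto (Etilde k) atImInfty (𝓝 1) := by
  have h4 : Tendsto (ModularForm.E₄ : ℍ → ℂ) atImInfty (𝓝 1) := tendsto_E _ (by decide)
  have h6 : Tendsto (ModularForm.E₆ : ℍ → ℂ) atImInfty (𝓝 1) := tendsto_E _ (by decide)
  unfold Etilde
  split_ifs
  exacts [by simpa using (h4.pow 2).mul h6, h4, h6, by simpa using h4.pow 2,
    by simpa using h4.mul h6, tendsto_const_nhds]

lemma factor_smul {k : ℤ} (hk : Even k) (γ : SL(2, ℤ)) (τ : ℍ) :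
    ModularForm.discriminant (γ • τ) ^ b k * Etilde k (γ • τ) =
      denom γ τ ^ k * (ModularForm.discriminant τ ^ b k * Etilde k τ) := by
  rw [discriminant_smul, Etilde_smul hk, mul_zpow, ← zpow_mul,
    show denom γ τ ^ k = denom γ τ ^ (12 * b k) * denom γ τ ^ (k - 12 * b k) by
      rw [← zpow_add₀ (denom_ne_zero _ τ)]; congr 1; ring]
  ring

/-! ### Behaviour at the cusp -/

lemma tendsto_im : Tendsto UpperHalfPlane.im atImInfty atTop := tendsto_comap

lemma tendsto_exp_neg_mul_im {c : ℝ} (hc : 0 < c) :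
    Tendsto (fun τ : ℍ ↦ Real.exp (-c * τ.im)) atImInfty (𝓝 0) :=
  Real.tendsto_exp_atBot.comp (tendsto_im.const_mul_atTop_of_neg (by simpa using hc))

/-- `P(q⁻¹) q^(deg P)` is the reversed polynomial at `q`, whose value at `q = 0` is the leading
coefficient. -/
lemma tendsto_mul_q_pow {F : ℍ → ℂ} {P : Polynomial ℂ} (hP : HasPrincipalPart F P) :
    Tendsto (fun τ ↦ F τ * q τ ^ P.natDegree) atImInfty (𝓝 P.leadingCoeff) := by
  obtain ⟨ε, hε, hO⟩ := hP
  have h1 : Tendsto (fun τ ↦ (F τ - P.eval (q τ)⁻¹) * q τ ^ P.natDegree) atImInfty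
      (𝓝 (0 * 0 ^ P.natDegree)) :=
    (hO.trans_tendsto (tendsto_exp_neg_mul_im hε)).mul (tendsto_q.pow _)
  have h2 : Tendsto (fun τ ↦ P.reverse.eval (q τ)) atImInfty (𝓝 (P.reverse.eval 0)) :=
    (P.reverse.continuous.tendsto 0).comp tendsto_q
  have h3 := h1.add h2
  rw [zero_mul, zero_add, ← Polynomial.coeff_zero_eq_eval_zero, Polynomial.coeff_zero_reverse] at h3
  refine h3.congr fun τ ↦ ?_
  have hq := q_ne_zero τ
  let _ : Invertible (q τ)⁻¹ := invertibleOfNonzero (inv_ne_zero hq)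
  have h4 := Polynomial.eval₂_reverse_mul_pow (RingHom.id ℂ) (q τ)⁻¹ P
  rw [invOf_eq_inv, inv_inv] at h4
  simp only [Polynomial.eval₂_id] at h4
  rw [← h4, inv_pow, sub_mul, inv_mul_cancel_right₀ (pow_ne_zero _ hq)]
  ring

lemma tendsto_ofComplex_affine {a d : ℕ} (ha : 0 < a) (hd : 0 < d) (b : ℕ) :
    Tendsto (fun τ : ℍ ↦ ofComplex ((a * (τ : ℂ) + b) / d)) atImInfty atImInfty := by
  refine tendsto_comap_iff.mpr ?_
  have : UpperHalfPlane.im ∘ (fun τ : ℍ ↦ ofComplex ((a * (τ : ℂ) + b) / d)) =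
      fun τ : ℍ ↦ (a / d : ℝ) * τ.im := by
    ext τ
    exact im_ofComplex_affine τ ha hd b
  rw [this]
  exact tendsto_im.const_mul_atTop (by positivity)

/-- Every Hecke translate other than `τ ↦ nτ` has a pole of order less than `mn` at `i∞`. -/
lemma tendsto_translate_mul_q_pow {F : ℍ → ℂ} {m n : ℕ} (hm : 1 ≤ m)
    (hF : Tendsto (fun τ ↦ F τ * q τ ^ m) atImInfty (𝓝 1)) {p : ℕ × ℕ}
    (hp : p ∈ n.divisorsAntidiagonal) {b : ℕ} (hb : b < p.2) :
    Tendsto (fun τ : ℍ ↦ F (ofComplex ((p.1 * (τ : ℂ) + b) / p.2)) * q τ ^ (m * n)) atImInfty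
      (𝓝 (if p = (n, 1) then 1 else 0)) := by
  obtain ⟨ha, hd⟩ := pos_of_mem_divisorsAntidiagonal hp
  obtain ⟨hpn, -⟩ := Nat.mem_divisorsAntidiagonal.mp hp
  have h1 := hF.comp (tendsto_ofComplex_affine ha hd b)
  have h2 (τ : ℍ) : F (ofComplex ((p.1 * (τ : ℂ) + b) / p.2)) * q τ ^ (m * n) =
      F (ofComplex ((p.1 * (τ : ℂ) + b) / p.2)) * q (ofComplex ((p.1 * (τ : ℂ) + b) / p.2)) ^ m *
        (q τ ^ (m * n) / q (ofComplex ((p.1 * (τ : ℂ) + b) / p.2)) ^ m) := by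
    have := pow_ne_zero m (q_ne_zero (ofComplex ((p.1 * (τ : ℂ) + b) / p.2)))
    field_simp
  simp only [h2]
  rw [← one_mul (if p = (n, 1) then (1 : ℂ) else 0)]
  refine Tendsto.mul h1 ?_
  split_ifs with h
  · subst h
    have hb0 : b = 0 := by simpa using hb
    subst hb0
    refine tendsto_const_nhds.congr fun τ ↦ ?_
    have e : q (ofComplex (((n : ℕ) * (τ : ℂ) + (0 : ℕ)) / (1 : ℕ))) = q τ ^ n := by
      rw [q, coe_ofComplex_affine τ ha hd 0, q, ← Complex.exp_nat_mul]
      congr 1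
      push_cast
      ring
    rw [e, ← pow_mul, mul_comm n m, div_self (pow_ne_zero _ (q_ne_zero τ))]
  · have hd1 : 1 < p.2 := by
      refine lt_of_le_of_ne hd fun h1 ↦ h ?_
      rw [← h1, mul_one] at hpn
      exact Prod.ext hpn h1.symm
    -- A translate has pole order `m a/d`, and `a/d < ad = n` once `d > 1`.
    have hlt : (0 : ℝ) < n - p.1 / p.2 := by
      have hd' : (1 : ℝ) < p.2 := by exact_mod_cast hd1
      have ha' : (0 : ℝ) < p.1 := by exact_mod_cast ha
      rw [← hpn, sub_pos, div_lt_iff₀ (by linarith)]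
      push_cast
      have h1 : (p.1 : ℝ) * 1 < p.1 * p.2 := by gcongr
      have h2 : (p.1 : ℝ) * p.2 * 1 < p.1 * p.2 * p.2 := by gcongr
      linarith
    have hm' : (0 : ℝ) < m := by exact_mod_cast hm
    rw [tendsto_zero_iff_norm_tendsto_zero]
    refine (tendsto_exp_neg_mul_im (c := 2 * Real.pi * m * (n - p.1 / p.2))
      (by have := Real.pi_pos; positivity)).congr fun τ ↦ ?_
    rw [norm_div, norm_pow, norm_pow, norm_q, norm_q, im_ofComplex_affine τ ha hd, ← Real.exp_nat_mul,
      ← Real.exp_nat_mul, ← Real.exp_sub]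
    congr 1
    push_cast
    ring

/-- Only `(a, d) = (n, 1)` survives in the limit, and `n^(k-1)` cancels the Hecke prefactor
`n^(1-k)`. -/
lemma tendsto_hecke_mul_q_pow (k : ℤ) {F : ℍ → ℂ} {m n : ℕ} (hm : 1 ≤ m) (hn : n ≠ 0)
    (hF : Tendsto (fun τ ↦ F τ * q τ ^ m) atImInfty (𝓝 1)) :
    Tendsto (fun τ ↦ (n : ℂ) ^ (k - 1) * hecke (2 - k) n F τ * q τ ^ (m * n)) atImInfty
      (𝓝 1) := by
  have hn' : (n : ℂ) ≠ 0 := by exact_mod_cast hn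
  have h : Tendsto (fun τ : ℍ ↦ ∑ p ∈ n.divisorsAntidiagonal,
      (p.2 : ℂ) ^ (-(2 - k)) * ∑ b ∈ Finset.range p.2,
        F (ofComplex ((p.1 * (τ : ℂ) + b) / p.2)) * q τ ^ (m * n)) atImInfty
      (𝓝 (∑ p ∈ n.divisorsAntidiagonal, (p.2 : ℂ) ^ (-(2 - k)) *
        ∑ b ∈ Finset.range p.2, if p = (n, 1) then 1 else 0)) :=
    tendsto_finsetSum _ fun p hp ↦ (tendsto_finsetSum _ fun b hb ↦
      tendsto_translate_mul_q_pow hm hF hp (Finset.mem_range.mp hb)).const_mul _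
  have hlim : (∑ p ∈ n.divisorsAntidiagonal, (p.2 : ℂ) ^ (-(2 - k)) *
        ∑ b ∈ Finset.range p.2, if p = (n, 1) then (1 : ℂ) else 0) = 1 := by
    rw [Finset.sum_eq_single (n, 1)]
    · simp
    · intro p _ hp
      simp [hp]
    · intro h
      simp [hn] at h
  rw [hlim] at h
  refine h.congr fun τ ↦ ?_
  rw [hecke, ← mul_assoc, ← zpow_add₀ hn', show k - 1 + (2 - k - 1) = 0 by ring, zpow_zero, one_mul,
    Finset.sum_mul]
  refine Finset.sum_congr rfl fun p _ ↦ ?_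
  rw [mul_assoc, Finset.sum_mul]

lemma tendsto_H {k : ℤ} {F : ℍ → ℂ} {m n : ℕ} (a : ℕ → ℂ) (hm : 1 ≤ m) (hn : 2 ≤ n)
    (hF : Tendsto (fun τ ↦ F τ * q τ ^ m) atImInfty (𝓝 1)) :
    Tendsto (fun τ ↦ H k a n F τ * q τ ^ ((m : ℤ) * n - b (k - 2))) atImInfty (𝓝 1) := by
  have h1 := tendsto_hecke_mul_q_pow k hm (by omega : n ≠ 0) hF
  -- Here `n ≥ 2` enters: `a(n) F` has pole order `m < mn`.
  have hpos : m * (n - 1) ≠ 0 := Nat.mul_ne_zero (by omega) (by omega)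
  have h2 := (hF.mul (tendsto_q.pow (m * (n - 1)))).const_mul (a n)
  rw [zero_pow hpos, mul_zero, mul_zero] at h2
  have h3 : Tendsto (fun τ ↦ (ModularForm.discriminant τ / q τ) ^ b (k - 2)) atImInfty (𝓝 1) := by
    simpa using tendsto_discriminant.zpow₀ (b (k - 2)) (Or.inl one_ne_zero)
  have h4 := (h3.mul (tendsto_Etilde (k - 2))).mul (h1.sub h2)
  rw [one_mul, one_mul, sub_zero] at h4
  refine h4.congr fun τ ↦ ?_
  have hq := q_ne_zero τ
  rw [H, div_zpow, zpow_sub₀ hq]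
  have e1 : q τ ^ ((m : ℤ) * n) = q τ ^ (m * n) := by exact_mod_cast zpow_natCast (q τ) (m * n)
  have e2 : q τ ^ (m * n) = q τ ^ m * q τ ^ (m * (n - 1)) := by
    rw [← pow_add]
    congr 1
    obtain ⟨l, rfl⟩ := Nat.exists_eq_add_of_le hn
    rw [show 2 + l - 1 = 1 + l by omega]
    ring
  rw [e1, e2]
  ring

/-! ### Assembly -/

/-- The matrix `-1` fixes `ℍ` pointwise, so in odd weight `F = -F`. This supplies the evenness of
`k`. -/
lemma even_of_slash_eq {k : ℤ} {F : ℍ → ℂ} (hF : ∀ γ : SL(2, ℤ), F ∣[k] γ = F) (h0 : F ≠ 0) :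
    Even k := by
  by_contra hk
  rw [Int.not_even_iff_odd] at hk
  refine h0 (funext fun τ ↦ ?_)
  have h := congrFun (hF (-1)) τ
  rw [ModularForm.SL_slash_apply] at h
  have hd : denom ((-1 : SL(2, ℤ)) : GL (Fin 2) ℝ) τ = -1 := by
    simp [denom]
  rw [hd, hk.neg.neg_one_zpow, ModularGroup.SL_neg_smul, one_smul] at h
  have : F τ = 0 := by linear_combination -(1 / 2) * h
  exact this

lemma isWeaklyHolomorphicFunction_H_and_exists_polynomial {k : ℤ} {m : ℕ} (hm : 1 ≤ m)
    {F : ℍ → ℂ} {a : ℕ → ℂ} (hF : IsWeakEigenform k F a) {P : Polynomial ℂ}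
    (hP : HasPrincipalPart F P) (hPmonic : P.Monic) (hPdeg : P.natDegree = m) {n : ℕ}
    (hn : 2 ≤ n) :
    IsWeaklyHolomorphicFunction (H k a n F) ∧
      ∃ Q : Polynomial ℝ, Q.Monic ∧ (Q.natDegree : ℤ) = (m : ℤ) * n - b (k - 2) ∧
        ∀ τ : ℍ, (Q.map Complex.ofRealHom).eval (j τ) = H k a n F τ := by
  have : NeZero n := ⟨by omega⟩
  obtain ⟨⟨hsmooth, hslash, -, -⟩, hreal, hG0, hG⟩ := hF
  have hlead : Tendsto (fun τ ↦ F τ * q τ ^ m) atImInfty (𝓝 1) := by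
    have := tendsto_mul_q_pow hP
    rwa [hPdeg, hPmonic.leadingCoeff] at this
  have hF0 : F ≠ 0 := by
    rintro rfl
    refine zero_ne_one (tendsto_nhds_unique (tendsto_const_nhds.congr fun τ ↦ ?_) hlead)
    simp
  have hk2 := even_of_slash_eq hslash hF0
  have hkeven : Even (k - 2) := by
    rw [← neg_sub]
    exact hk2.neg
  have hdiff (τ : ℍ) : DifferentiableAt ℝ (F ∘ ofComplex) τ :=
    (hsmooth.differentiableOn (by simp)).differentiableAt (isOpen_upperHalfPlaneSet.mem_nhds τ.2)
  have hcont : Continuous F := by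
    have h : F = (F ∘ ofComplex) ∘ ((↑) : ℍ → ℂ) := by ext τ; simp
    rw [h]
    exact continuous_iff_continuousAt.mpr fun τ ↦
      ContinuousAt.comp (hdiff τ).continuousAt continuous_coe.continuousAt
  have hper (τ : ℍ) : F ((1 : ℝ) +ᵥ τ) = F τ := by
    rw [one_vadd_eq_T_smul, apply_smul_of_slash_eq (hslash _), ModularGroup.denom_apply]
    simp [ModularGroup.T]
  have hFJ := apply_J_smul_of_hasRealFourierCoeffs hcont hper hreal
  have ha : conj (a n) = a n := conj_eigenvalue_eq (xi_one_vadd _ hper) (xi_J_smul _ hdiff hFJ) hG0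
    (hG n (by omega))
  have hhdiff (τ : ℍ) : DifferentiableAt ℝ (hecke (2 - k) n F ∘ ofComplex) τ :=
    (hasFDerivAt_hecke _ _ hdiff τ).differentiableAt
  set D : ℍ → ℂ := fun τ ↦ (n : ℂ) ^ (k - 1) * hecke (2 - k) n F τ - a n * F τ with hD
  have hDdiff (τ : ℍ) : DifferentiableAt ℝ (D ∘ ofComplex) τ :=
    ((hhdiff τ).const_mul _).sub ((hdiff τ).const_mul _)
  have hDm : MDiff D := by
    -- `ξ D = a(n) G - conj (a(n)) G`, which vanishes by `ha`.
    refine mdiff_of_xi_eq_zero (κ := 2 - k) hDdiff fun τ ↦ ?_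
    rw [hD, xi_mul_sub_mul _ _ _ hhdiff hdiff, map_zpow₀, map_natCast, xi_hecke k (NeZero.ne n) hdiff,
      hG n (by omega), ha, Pi.smul_apply, smul_eq_mul, sub_self]
  have hDsmul (γ : SL(2, ℤ)) (τ : ℍ) : D (γ • τ) = denom γ τ ^ (2 - k) * D τ := by
    simp only [hD]
    rw [apply_smul_of_slash_eq (hecke_slash hslash γ), apply_smul_of_slash_eq (hslash γ)]
    ring
  have hHD (τ : ℍ) : H k a n F τ =
    ModularForm.discriminant τ ^ b (k - 2) * Etilde (k - 2) τ * D τ := rfl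
  have hinv (γ : SL(2, ℤ)) (τ : ℍ) : H k a n F (γ • τ) = H k a n F τ := by
    rw [hHD, hHD, factor_smul hkeven, hDsmul, mul_mul_mul_comm, ← mul_assoc,
      mul_comm (_ ^ (k - 2)), ← zpow_add₀ (denom_ne_zero _ τ)]
    simp
  have hHm : MDiff (H k a n F) := by
    have h1 := mdiff_zpow mdiff_discriminant ModularForm.discriminant_ne_zero (b (k - 2))
    have h2 := mdiff_Etilde (k - 2)
    rw [UpperHalfPlane.mdifferentiable_iff] at *
    exact fun z hz ↦ ((h1 z hz).mul (h2 z hz)).mul (hDm z hz)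
  have hHJ (τ : ℍ) : H k a n F (J • τ) = conj (H k a n F τ) := by
    simp only [hHD, hD, discriminant_J_smul, Etilde_J_smul, hecke_J_smul _ n hper hFJ, hFJ, map_mul,
      map_sub, map_zpow₀, map_natCast, ha]
  have hlim := tendsto_H (k := k) a hm hn hlead
  refine ⟨⟨hinv, hHm, meromorphicAt_cuspFunction _ (fun τ ↦ ?_) hHm hlim⟩,
    exists_monic_real_polynomial _ hinv hHm hlim hHJ⟩
  rw [one_vadd_eq_T_smul, hinv]

end WeakEigenform

end

theorem theorem1 (k : ℤ) (m : ℕ) (hm : 1 ≤ m) (F : UpperHalfPlane → ℂ) (a : ℕ → ℂ)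
    (hF : WeakEigenform.IsWeakEigenform k F a)
    (P : Polynomial ℂ) (hP : WeakEigenform.HasPrincipalPart F P)
    (hPmonic : P.Monic) (hPdeg : P.natDegree = m) :
    ∀ n : ℕ, 2 ≤ n →
      WeakEigenform.IsWeaklyHolomorphicFunction (WeakEigenform.H k a n F) ∧
      ∃ Pn : Polynomial ℝ, Pn.Monic ∧
        (Pn.natDegree : ℤ) = (m : ℤ) * n - WeakEigenform.b (k - 2) ∧
        ∀ τ : UpperHalfPlane,
          (Pn.map Complex.ofRealHom).eval (WeakEigenform.j τ) = WeakEigenform.H k a n F τ := fun _ hn ↦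
  WeakEigenform.isWeaklyHolomorphicFunction_H_and_exists_polynomial hm hF hP hPmonic hPdeg hn
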